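/- An \emph{involutive quantal frame} $Q$ is a frame with an associative multiplication preserving joins in each variable and a join-preserving involution with $(ab)^*=b^*a^*$; no unit is required. Let $R(Q)=\{z: z1\le z\}$, a subframe of $Q$, and $\upsilon(a)=\bigvee\{x\wedge y: xy^*\le a\}$. $Q$ is an \emph{open quantal frame} if for all $a,b,c\in Q$: $b(a1\wedge c)=(b\wedge 1a^*)c$ (i.e. $Q$ is \emph{balanced}); $\upsilon(a)\in R(Q)$; $\bigvee\{x: xx^*x\le a\}=a$; and $(a1\wedge b)c=a1\wedge bc$. Let $Q$ be an open quantal frame. For $U\in R(Q)$ let $\widetilde U=\{z\in R(Q): z\le U\}$. A \emph{local bisection} is a pair $\sigma=(U,s)$, where $U\in R(Q)$ and $s:\widetilde U\to Q$ is a map of locales, with inverse image frame homomorphism $s^*:Q\to\widetilde U$, such that $s^*(z)=z\wedge U$ for $z\in R(Q)$ and, for some $V\in R(Q)$ and some frame isomorphism $\alpha^*:\widetilde V\to\widetilde U$, $s^*(z^*)=\alpha^*(z\wedge V)$ for all $z\in R(Q)$. Then $\sigma^{-1}=(V,\,a\mapsto(\alpha^*)^{-1}(s^*(a^*)))$ is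 a local bisection. Put $\sigma\cdot a=\bigvee\{s^*(x)\wedge y: x^*y\le a\}$. The product $\sigma\tau$ is the local bisection with domain $s_\sigma^*(U_\tau^*)$ and inverse image $a\mapsto\bigvee\{s_\sigma^*(x\wedge s_\tau^*(y)^*): xy\le a\}$, whenever this map preserves joins (as it does if $\tau\cdot(-)$ does). $Q$ is \emph{weakly multiplicative} if $\upsilon$ and every $\sigma\cdot(-)$ preserve joins and the product of local bisections is associative. In that case the set $S(Q)$ of local bisections is an inverse semigroup; let $\widehat Q=\mathcal L^\vee(S(Q))$ be its completion, whose elements are the subsets of $S(Q)$ that are downwards closed in the natural order and closed under joins of compatible subsets, ordered by inclusion, the product of two such subsets being the smallest one containing all products of their elements. Let $\widehat\sigma$ be the principal down-set of $\sigma$, and $j:Q\to\widehat Q$, $j(a)=\{\sigma: s_\sigma^*(a)=U_\sigma\}$. Let $R(Q)$ act on $Q$ on the left by $z\cdot b=b\wedge z$ and on the right by $a\cdot z=a\wedge z^*$, and on $\widehat Q$ on the right by $X\cdot z=X\wedge j(z^*)$; tensor products over $R(Q)$ are those of sup-lattices with these actions. In an open quantal frame the multiplication induces the \emph{reduced multiplication}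 $\mu_0:Q\otimes_{R(Q)}Q\to Q$, $a\otimes b\mapsto ab$. $Q$ is \emph{weakly embeddable} if $\widehat\sigma\, j(a)=j(\sigma\cdot a)$ for all $\sigma\in S(Q)$, $a\in Q$, and \emph{embeddable} if moreover $j\otimes\mathrm{id}:Q\otimes_{R(Q)}Q\to\widehat Q\otimes_{R(Q)}Q$ is mono (injective). $Q$ is \emph{multiplicative} if it is balanced and the right adjoint of $\mu_0$ preserves joins. \textbf{Theorem.} If a weakly multiplicative open quantal frame $Q$ is embeddable, then it is multiplicative. -/

import Mathlib

universe u v w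

/-! ### Involutive quantal frames -/

/-- An involutive quantal frame: a frame with an associative multiplication that preserves joins
in each variable, and a join-preserving involution `star` with `(ab)* = b*a*`. No multiplicative
unit is required. -/
class InvolutiveQuantalFrame (Q : Type u) extends
    Order.Frame Q, Semigroup Q, IsQuantale Q, StarMul Q where
  star_sSup : ∀ S : Set Q, star (sSup S) = ⨆ a ∈ S, star a

namespace InvolutiveQuantalFrame

section Basic

variable {Q : Type u} [InvolutiveQuantalFrame Q]

theorem star_mono {a b : Q} (h : a ≤ b) : star a ≤ star b := by
  have h1 : star (sSup {a, b}) = ⨆ c ∈ ({a, b} : Set Q), star c := star_sSup _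
  rw [sSup_pair, sup_eq_right.2 h, iSup_pair] at h1
  rw [h1]; exact le_sup_left

theorem star_le_iff {a b : Q} : star a ≤ b ↔ a ≤ star b :=
  ⟨fun h => by simpa using star_mono h, fun h => by simpa using star_mono h⟩

theorem star_top : star (⊤ : Q) = ⊤ := top_le_iff.1 (by
  rw [← star_le_iff]; exact le_top)

theorem star_inf (a b : Q) : star (a ⊓ b) = star a ⊓ star b := by
  apply le_antisymm
  · exact le_inf (star_mono inf_le_left) (star_mono inf_le_right)
  · rw [← star_le_iff]
    exact le_inf (star_le_iff.2 inf_le_left) (star_le_iff.2 inf_le_right)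

theorem mul_mono {a b c d : Q} (h : a ≤ b) (h' : c ≤ d) : a * c ≤ b * d := by
  have h1 : sSup {a, b} * c = ⨆ y ∈ ({a, b} : Set Q), y * c := sSup_mul_distrib
  rw [sSup_pair, sup_eq_right.2 h, iSup_pair] at h1
  have h2 : b * sSup {c, d} = ⨆ y ∈ ({c, d} : Set Q), b * y := mul_sSup_distrib
  rw [sSup_pair, sup_eq_right.2 h', iSup_pair] at h2
  calc a * c ≤ b * c := by rw [h1]; exact le_sup_left
    _ ≤ b * d := by rw [h2]; exact le_sup_left

/-- Right-sided elements: `a1 ≤ a`. -/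
def IsRightSided (a : Q) : Prop := a * ⊤ ≤ a

theorem IsRightSided.top : IsRightSided (⊤ : Q) := le_top

theorem IsRightSided.inf {a b : Q} (ha : IsRightSided a) (hb : IsRightSided b) :
    IsRightSided (a ⊓ b) :=
  le_inf ((mul_mono inf_le_left le_rfl).trans ha) ((mul_mono inf_le_right le_rfl).trans hb)

theorem IsRightSided.sSup {S : Set Q} (h : ∀ a ∈ S, IsRightSided a) : IsRightSided (sSup S) := by
  unfold IsRightSided
  rw [sSup_mul_distrib]
  exact iSup₂_le fun a ha => (h a ha).trans (le_sSup ha)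

theorem isRightSided_mul_top (a : Q) : IsRightSided (a * ⊤) := by
  unfold IsRightSided
  rw [mul_assoc]
  exact mul_mono le_rfl le_top

/-- `υ(a) = ⋁ { x ∧ y : x y* ≤ a }`. -/
def upsilon (a : Q) : Q := sSup {c | ∃ x y : Q, x * star y ≤ a ∧ x ⊓ y = c}

theorem upsilon_mono {a b : Q} (h : a ≤ b) : upsilon a ≤ upsilon b :=
  sSup_le_sSup fun _ ⟨x, y, hxy, hc⟩ => ⟨x, y, hxy.trans h, hc⟩

theorem le_upsilon {a x : Q} (h : x * star x ≤ a) : x ≤ upsilon a :=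
  le_sSup ⟨x, x, h, inf_idem x⟩

theorem upsilon_inf (a b : Q) : upsilon (a ⊓ b) = upsilon a ⊓ upsilon b := by
  apply le_antisymm (le_inf (upsilon_mono inf_le_left) (upsilon_mono inf_le_right))
  unfold upsilon
  rw [sSup_inf_sSup]
  refine iSup₂_le ?_
  rintro ⟨-, -⟩ ⟨⟨x, y, h, rfl⟩, ⟨x', y', h', rfl⟩⟩
  refine le_sSup ⟨x ⊓ x', y ⊓ y', le_inf ?_ ?_, inf_inf_inf_comm _ _ _ _⟩
  · exact (mul_mono inf_le_left (star_mono inf_le_left)).trans h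
  · exact (mul_mono inf_le_right (star_mono inf_le_right)).trans h'

theorem upsilon_star {a : Q} : upsilon (star a) = upsilon a := by
  have key : ∀ a : Q, upsilon (star a) ≤ upsilon a := by
    intro a
    refine sSup_le ?_
    rintro _ ⟨x, y, h, rfl⟩
    refine le_sSup ⟨y, x, ?_, inf_comm _ _⟩
    have := star_mono h
    simpa using this
  exact le_antisymm (key a) (by simpa using key (star a))

end Basic

section Classes

variable (Q : Type u) [InvolutiveQuantalFrame Q]

/-- The set `R(Q)` of right-sided elements of `Q`. -/
abbrev RS : Type u := {z : Q // IsRightSided z}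

/-- `Q` is balanced. -/
class IsBalanced : Prop where
  balanced : ∀ a b c : Q, b * (a * ⊤ ⊓ c) = (b ⊓ ⊤ * star a) * c

/-- `Q` is a semiopen quantal frame: it is balanced, `υ` takes values in `R(Q)`, and every `a`
is the join of the `x` with `x x* x ≤ a`. -/
class IsSemiopen : Prop extends IsBalanced Q where
  upsilon_rightSided : ∀ a : Q, IsRightSided (upsilon a)
  sSup_mul_star_mul : ∀ a : Q, sSup {x : Q | x * star x * x ≤ a} = a

/-- `Q` is an open quantal frame. -/
class IsOpenQuantalFrame : Prop extends IsSemiopen Q where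
  inf_mul : ∀ a b c : Q, (a * ⊤ ⊓ b) * c = a * ⊤ ⊓ b * c

end Classes

section Semiopen

variable {Q : Type u} [InvolutiveQuantalFrame Q] [IsSemiopen Q]

theorem le_of_mul_star_mul_le {a x : Q} (h : x * star x * x ≤ a) : x ≤ a := by
  rw [← IsSemiopen.sSup_mul_star_mul a]; exact le_sSup h

theorem le_mul_top (a : Q) : a ≤ a * ⊤ :=
  (le_of_mul_star_mul_le le_rfl).trans (by rw [mul_assoc]; exact mul_mono le_rfl le_top)

theorem le_top_mul (a : Q) : a ≤ ⊤ * a :=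
  (le_of_mul_star_mul_le le_rfl).trans (mul_mono le_top le_rfl)

theorem IsRightSided.mul_top_eq {z : Q} (hz : IsRightSided z) : z * ⊤ = z :=
  le_antisymm hz (le_mul_top z)

theorem IsRightSided.top_mul_star_eq {z : Q} (hz : IsRightSided z) : ⊤ * star z = star z := by
  rw [← star_top, ← star_mul, hz.mul_top_eq]

theorem balanced_rightSided {z : Q} (hz : IsRightSided z) (b c : Q) :
    b * (z ⊓ c) = (b ⊓ star z) * c := by
  have h := IsBalanced.balanced z b c
  rwa [hz.mul_top_eq, hz.top_mul_star_eq] at h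

theorem upsilon_rightSided_eq {z : Q} (hz : IsRightSided z) : upsilon z = z := by
  apply le_antisymm
  · refine sSup_le ?_
    rintro _ ⟨x, y, h, rfl⟩
    apply le_of_mul_star_mul_le
    calc (x ⊓ y) * star (x ⊓ y) * (x ⊓ y) ≤ x * star y * ⊤ :=
          mul_mono (mul_mono inf_le_left (star_mono inf_le_right)) le_top
      _ ≤ z * ⊤ := mul_mono h le_rfl
      _ ≤ z := hz
  · exact le_upsilon ((mul_mono le_rfl le_top).trans hz)

theorem upsilon_inf_le_mul (x y : Q) : upsilon x ⊓ y ≤ x * y := by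
  unfold upsilon
  rw [sSup_inf_eq]
  refine iSup₂_le ?_
  rintro _ ⟨p, q, h, rfl⟩
  apply le_of_mul_star_mul_le
  refine mul_mono (le_trans (mul_mono ?_ (star_mono ?_)) h) inf_le_right
  · exact inf_le_left.trans inf_le_left
  · exact inf_le_left.trans inf_le_right

theorem sSup_upsilon_inf (a : Q) :
    sSup {c | ∃ x y : Q, x * y ≤ a ∧ upsilon x ⊓ y = c} = a := by
  apply le_antisymm
  · refine sSup_le ?_
    rintro _ ⟨x, y, h, rfl⟩
    exact (upsilon_inf_le_mul x y).trans h
  · conv_lhs => rw [← IsSemiopen.sSup_mul_star_mul a]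
    refine sSup_le fun x hx => ?_
    refine le_sSup_of_le ⟨x * star x, x, hx, rfl⟩ (le_inf (le_upsilon le_rfl) le_rfl)

end Semiopen

/-! ### Tensor products of sup-lattices over actions -/

section Tensor

variable {A : Type u} {B : Type v} {L : Type w} [CompleteLattice A] [CompleteLattice B]

/-- The tensor product `A ⊗_L B` of two complete lattices, where `L` acts on `A` on the right by
`ra` and on `B` on the left by `la`: its elements are the down-sets of `A × B` that are closed
under joins in each variable and do not distinguish `(a·z, b)` from `(a, z·b)`; the order is
inclusion. See `ModTensor.lift_sSup`, `ModTensor.lift_tmul` and `ModTensor.lift_unique` for the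
universal property. -/
@[ext]
structure ModTensor (ra : A → L → A) (la : L → B → B) where
  carrier : Set (A × B)
  lower : ∀ {a a' : A} {b b' : B}, a' ≤ a → b' ≤ b → (a, b) ∈ carrier → (a', b') ∈ carrier
  sSup_left : ∀ (S : Set A) (b : B), (∀ a ∈ S, (a, b) ∈ carrier) → (sSup S, b) ∈ carrier
  sSup_right : ∀ (a : A) (S : Set B), (∀ b ∈ S, (a, b) ∈ carrier) → (a, sSup S) ∈ carrier
  middle : ∀ (a : A) (z : L) (b : B), (ra a z, b) ∈ carrier ↔ (a, la z b) ∈ carrier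

namespace ModTensor

variable {ra : A → L → A} {la : L → B → B}

instance : PartialOrder (ModTensor ra la) :=
  PartialOrder.lift ModTensor.carrier fun _ _ h => ModTensor.ext h

instance : InfSet (ModTensor ra la) where
  sInf T :=
    { carrier := {p | ∀ I ∈ T, p ∈ I.carrier}
      lower := fun h h' hp I hI => I.lower h h' (hp I hI)
      sSup_left := fun S b h I hI => I.sSup_left S b fun a ha => h a ha I hI
      sSup_right := fun a S h I hI => I.sSup_right a S fun b hb => h b hb I hI
      middle := fun a z b => forall₂_congr fun I _ => I.middle a z b }

instance : CompleteLattice (ModTensor ra la) :=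
  completeLatticeOfInf _ fun _ =>
    ⟨fun I hI _ hp => hp I hI, fun _ hJ _ hp _ hI => hJ hI hp⟩

/-- The pure tensor `a ⊗ b`. -/
def tmul (ra : A → L → A) (la : L → B → B) (a : A) (b : B) : ModTensor ra la :=
  sInf {I | (a, b) ∈ I.carrier}

/-- The map `A ⊗_L B → C` induced by `φ : A × B → C`. -/
def lift {C : Type*} [CompleteLattice C] (φ : A → B → C) (I : ModTensor ra la) : C :=
  sSup {c | ∃ a b, (a, b) ∈ I.carrier ∧ φ a b = c}

theorem mem_tmul (a : A) (b : B) : (a, b) ∈ (tmul ra la a b).carrier := fun _ hI => hI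

theorem tmul_le {a : A} {b : B} {I : ModTensor ra la} : tmul ra la a b ≤ I ↔ (a, b) ∈ I.carrier :=
  ⟨fun h => h (mem_tmul a b), fun h => sInf_le h⟩

theorem eq_sSup_tmul (I : ModTensor ra la) :
    I = sSup {J | ∃ a b, (a, b) ∈ I.carrier ∧ tmul ra la a b = J} := by
  apply le_antisymm
  · rintro ⟨a, b⟩ h
    exact tmul_le.1 (le_sSup ⟨a, b, h, rfl⟩)
  · refine sSup_le ?_
    rintro _ ⟨a, b, h, rfl⟩
    exact tmul_le.2 h

/-- Middle-linear bimorphisms: maps preserving joins in each variable and compatible with the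
actions of `L`. -/
structure IsMiddleLinear {C : Type*} [CompleteLattice C] (ra : A → L → A) (la : L → B → B)
    (φ : A → B → C) : Prop where
  map_sSup_left : ∀ (S : Set A) (b : B), φ (sSup S) b = ⨆ a ∈ S, φ a b
  map_sSup_right : ∀ (a : A) (S : Set B), φ a (sSup S) = ⨆ b ∈ S, φ a b
  map_middle : ∀ (a : A) (z : L) (b : B), φ (ra a z) b = φ a (la z b)

section Universal

variable {C : Type*} [CompleteLattice C] {φ : A → B → C}

theorem IsMiddleLinear.mono (h : IsMiddleLinear ra la φ) {a a' : A} {b b' : B} (ha : a' ≤ a)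
    (hb : b' ≤ b) : φ a' b' ≤ φ a b := by
  have h1 := h.map_sSup_left {a', a} b'
  rw [sSup_pair, sup_eq_right.2 ha, iSup_pair] at h1
  have h2 := h.map_sSup_right a {b', b}
  rw [sSup_pair, sup_eq_right.2 hb, iSup_pair] at h2
  calc φ a' b' ≤ φ a b' := by rw [h1]; exact le_sup_left
    _ ≤ φ a b := by rw [h2]; exact le_sup_left

/-- The right adjoint of `lift φ`. -/
def IsMiddleLinear.adjoint (h : IsMiddleLinear ra la φ) (c : C) : ModTensor ra la where
  carrier := {p | φ p.1 p.2 ≤ c}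
  lower := fun ha hb hp => (h.mono ha hb).trans hp
  sSup_left := fun S b hS => by
    change φ (sSup S) b ≤ c
    rw [h.map_sSup_left]; exact iSup₂_le hS
  sSup_right := fun a S hS => by
    change φ a (sSup S) ≤ c
    rw [h.map_sSup_right]; exact iSup₂_le hS
  middle := fun a z b => by
    change φ (ra a z) b ≤ c ↔ φ a (la z b) ≤ c
    rw [h.map_middle]

theorem IsMiddleLinear.gc (h : IsMiddleLinear ra la φ) :
    GaloisConnection (lift φ : ModTensor ra la → C) h.adjoint := by
  intro I c
  constructor
  · rintro hc ⟨a, b⟩ hab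
    exact (le_sSup ⟨a, b, hab, rfl⟩ : φ a b ≤ lift φ I).trans hc
  · intro hI
    refine sSup_le ?_
    rintro _ ⟨a, b, hab, rfl⟩
    exact hI hab

theorem lift_sSup (h : IsMiddleLinear ra la φ) (T : Set (ModTensor ra la)) :
    lift φ (sSup T) = ⨆ I ∈ T, lift φ I := h.gc.l_sSup

theorem lift_tmul (h : IsMiddleLinear ra la φ) (a : A) (b : B) :
    lift φ (tmul ra la a b) = φ a b :=
  le_antisymm ((h.gc _ _).2 (tmul_le.2 (le_refl (φ a b)))) (le_sSup ⟨a, b, mem_tmul a b, rfl⟩)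

theorem lift_unique {f : ModTensor ra la → C}
    (hf : ∀ T : Set (ModTensor ra la), f (sSup T) = ⨆ I ∈ T, f I)
    (hφ : ∀ a b, f (tmul ra la a b) = φ a b) : f = lift φ := by
  funext I
  conv_lhs => rw [eq_sSup_tmul I]
  rw [hf, lift, sSup_eq_iSup]
  apply le_antisymm
  · refine iSup₂_le ?_
    rintro _ ⟨a, b, hab, rfl⟩
    exact le_iSup₂_of_le (φ a b) ⟨a, b, hab, rfl⟩ (hφ a b).le
  · refine iSup₂_le ?_
    rintro _ ⟨a, b, hab, rfl⟩
    exact le_iSup₂_of_le (tmul ra la a b) ⟨a, b, hab, rfl⟩ (hφ a b).ge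

theorem isMiddleLinear_tmul : IsMiddleLinear ra la (tmul ra la) where
  map_sSup_left S b := by
    apply le_antisymm
    · exact tmul_le.2 (ModTensor.sSup_left _ S b fun a ha =>
        tmul_le.1 (le_iSup₂_of_le (f := fun a _ => tmul ra la a b) a ha le_rfl))
    · exact iSup₂_le fun a ha => tmul_le.2 (ModTensor.lower _ (le_sSup ha) le_rfl (mem_tmul _ _))
  map_sSup_right a S := by
    apply le_antisymm
    · exact tmul_le.2 (ModTensor.sSup_right _ a S fun b hb =>
        tmul_le.1 (le_iSup₂_of_le (f := fun b _ => tmul ra la a b) b hb le_rfl))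
    · exact iSup₂_le fun b hb => tmul_le.2 (ModTensor.lower _ le_rfl (le_sSup hb) (mem_tmul _ _))
  map_middle a z b := by
    apply le_antisymm
    · exact tmul_le.2 ((ModTensor.middle _ a z b).2 (mem_tmul _ _))
    · exact tmul_le.2 ((ModTensor.middle _ a z b).1 (mem_tmul _ _))

end Universal

end ModTensor

end Tensor

/-! ### Inverse semigroups and their completion -/

/-- Inverse semigroups, in the standard axiomatization as semigroups with a unary operation
satisfying `(x⁻¹)⁻¹ = x`, `x x⁻¹ x = x` and `(x x⁻¹)(y y⁻¹) = (y y⁻¹)(x x⁻¹)`. -/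
class InverseSemigroup (S : Type u) extends Semigroup S, Inv S where
  inv_inv : ∀ x : S, x⁻¹⁻¹ = x
  mul_inv_mul : ∀ x : S, x * x⁻¹ * x = x
  mul_inv_comm : ∀ x y : S, (x * x⁻¹) * (y * y⁻¹) = (y * y⁻¹) * (x * x⁻¹)

section Completion

variable {S : Type u} [InverseSemigroup S]

/-- The natural order of an inverse semigroup. -/
def NatLE (x y : S) : Prop := x = x * x⁻¹ * y

theorem NatLE.trans {x y z : S} (h : NatLE x y) (h' : NatLE y z) : NatLE x z := by
  have h1 : y * y⁻¹ * x = x := by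
    conv_lhs => rw [h, ← mul_assoc, ← InverseSemigroup.mul_inv_comm, mul_assoc,
      InverseSemigroup.mul_inv_mul]
    exact h.symm
  have h2 : x * x⁻¹ * (y * y⁻¹) = x * x⁻¹ := by
    rw [InverseSemigroup.mul_inv_comm, ← mul_assoc, h1]
  unfold NatLE
  conv_rhs => rw [← h2, mul_assoc, ← h']
  exact h

/-- A compatible subset: `x y⁻¹` and `x⁻¹ y` are idempotent for all `x, y` in it. -/
def IsCompatibleSet (X : Set S) : Prop :=
  ∀ x ∈ X, ∀ y ∈ X, IsIdempotentElem (x * y⁻¹) ∧ IsIdempotentElem (x⁻¹ * y)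

/-- `s` is the join of `X` in the natural order. -/
def IsJoin (X : Set S) (s : S) : Prop :=
  (∀ x ∈ X, NatLE x s) ∧ ∀ t, (∀ x ∈ X, NatLE x t) → NatLE s t

/-- The completion `L^∨(S)`: the down-sets of `S` (in the natural order) that are closed under
the joins of their compatible subsets, ordered by inclusion. -/
@[ext]
structure Completion (S : Type u) [InverseSemigroup S] where
  carrier : Set S
  lower : ∀ {x y : S}, NatLE x y → y ∈ carrier → x ∈ carrier
  join_mem : ∀ (X : Set S) (s : S), X ⊆ carrier → IsCompatibleSet X → IsJoin X s → s ∈ carrier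

namespace Completion

instance : PartialOrder (Completion S) :=
  PartialOrder.lift Completion.carrier fun _ _ h => Completion.ext h

instance : InfSet (Completion S) where
  sInf T :=
    { carrier := {s | ∀ I ∈ T, s ∈ I.carrier}
      lower := fun h hy I hI => I.lower h (hy I hI)
      join_mem := fun X s hX hc hs I hI => I.join_mem X s (fun x hx => hX hx I hI) hc hs }

instance : CompleteLattice (Completion S) :=
  completeLatticeOfInf _ fun _ =>
    ⟨fun I hI _ hp => hp I hI, fun _ hJ _ hp _ hI => hJ hI hp⟩

/-- The product of `I` and `J` is generated by the products of their elements. -/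
instance : Mul (Completion S) where
  mul I J := sInf {K | ∀ x ∈ I.carrier, ∀ y ∈ J.carrier, x * y ∈ K.carrier}

/-- The principal ideal of `s`. -/
def principal (s : S) : Completion S where
  carrier := {x | NatLE x s}
  lower := fun h hy => h.trans hy
  join_mem := fun _ _ hX _ hs => hs.2 s hX

end Completion

end Completion

/-! ### Local bisections -/

section LocalBisection

variable {Q : Type u} [InvolutiveQuantalFrame Q]

/-- The frame `Ũ` of right-sided elements below `U`; its joins and its binary meets are those
of `Q`, and its top is `U`. -/
abbrev Seg (U : Q) : Type u := {z : Q // IsRightSided z ∧ z ≤ U}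

variable (Q) in
/-- A local bisection `(U, s)` of `Q`. The map of locales `s : Ũ → Q` is given by its inverse
image homomorphism `sec = s* : Q → Ũ`, a frame homomorphism. The field `sec_rightSided_eq` says
that `s` is a local section of `d` (where `d*` is the inclusion of `R(Q)` in `Q`), and `open_mono`
says that `r ∘ s` (where `r*(z) = z*`) factors as an isomorphism of locales followed by the
inclusion of the open sublocale `Ṽ` of `R(Q)`, in other words that it is an open regular
monomorphism. -/
@[ext]
structure LocalBisection where
  dom : Q
  sec : Q → Q
  dom_rightSided : IsRightSided dom
  sec_rightSided : ∀ a, IsRightSided (sec a)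
  sec_top : sec ⊤ = dom
  sec_inf : ∀ a b, sec (a ⊓ b) = sec a ⊓ sec b
  sec_sSup : ∀ S : Set Q, sec (sSup S) = ⨆ a ∈ S, sec a
  sec_rightSided_eq : ∀ z, IsRightSided z → sec z = z ⊓ dom
  open_mono : ∃ (V : RS Q) (α : Seg V.1 ≃o Seg dom), ∀ z : RS Q,
    sec (star z.1) = (α ⟨z.1 ⊓ V.1, z.2.inf V.2, inf_le_right⟩).1

namespace LocalBisection

variable (σ τ : LocalBisection Q)

/-- The codomain `V` of `σ`. -/
noncomputable def cod : Q := σ.open_mono.choose.1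

theorem cod_rightSided : IsRightSided σ.cod := σ.open_mono.choose.2

/-- The action of `σ`, in terms of inverse images: the isomorphism of frames `α* : Ṽ → Ũ`. -/
noncomputable def action : Seg σ.cod ≃o Seg σ.dom := σ.open_mono.choose_spec.choose

theorem sec_star {z : Q} (hz : IsRightSided z) :
    σ.sec (star z) = (σ.action ⟨z ⊓ σ.cod, hz.inf σ.cod_rightSided, inf_le_right⟩).1 :=
  σ.open_mono.choose_spec.choose_spec ⟨z, hz⟩

theorem sec_mono {a b : Q} (h : a ≤ b) : σ.sec a ≤ σ.sec b := by
  have h1 := σ.sec_inf a b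
  rw [inf_eq_left.2 h] at h1
  rw [h1]; exact inf_le_right

theorem sec_le (a : Q) : σ.sec a ≤ σ.dom := by
  rw [← σ.sec_top]; exact σ.sec_mono le_top

/-- The inverse image homomorphism `t* : Q → Ṽ` of the codomain section `t = s ∘ α⁻¹`. -/
noncomputable def tsec (a : Q) : Q :=
  (σ.action.symm ⟨σ.sec a, σ.sec_rightSided a, σ.sec_le a⟩).1

theorem tsec_rightSided (a : Q) : IsRightSided (σ.tsec a) := (σ.action.symm _).2.1

theorem tsec_le (a : Q) : σ.tsec a ≤ σ.cod := (σ.action.symm _).2.2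

theorem sec_star_tsec (a : Q) : σ.sec (star (σ.tsec a)) = σ.sec a := by
  rw [σ.sec_star (σ.tsec_rightSided a)]
  have : (⟨σ.tsec a ⊓ σ.cod, (σ.tsec_rightSided a).inf σ.cod_rightSided, inf_le_right⟩ :
      Seg σ.cod) = σ.action.symm ⟨σ.sec a, σ.sec_rightSided a, σ.sec_le a⟩ :=
    Subtype.ext (inf_eq_left.2 (σ.tsec_le a))
  rw [this, OrderIso.apply_symm_apply]

theorem le_of_sec_star_le {z w : Q} (hz : IsRightSided z) (hw : IsRightSided w)
    (h : σ.sec (star z) ≤ σ.sec (star w)) : z ⊓ σ.cod ≤ w ⊓ σ.cod := by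
  rw [σ.sec_star hz, σ.sec_star hw] at h
  exact σ.action.le_iff_le.1 h

theorem tsec_eq_of {a z : Q} (hz : IsRightSided z) (h : σ.sec (star z) = σ.sec a) :
    σ.tsec a = z ⊓ σ.cod := by
  rw [← σ.sec_star_tsec a] at h
  conv_lhs => rw [← inf_eq_left.2 (σ.tsec_le a)]
  exact le_antisymm (σ.le_of_sec_star_le (σ.tsec_rightSided a) hz h.ge)
    (σ.le_of_sec_star_le hz (σ.tsec_rightSided a) h.le)

theorem tsec_star {z : Q} (hz : IsRightSided z) : σ.tsec (star z) = z ⊓ σ.cod :=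
  σ.tsec_eq_of hz rfl

theorem tsec_top : σ.tsec ⊤ = σ.cod := by
  rw [← star_top, σ.tsec_star IsRightSided.top, top_inf_eq]

theorem tsec_inf (a b : Q) : σ.tsec (a ⊓ b) = σ.tsec a ⊓ σ.tsec b := by
  rw [σ.tsec_eq_of ((σ.tsec_rightSided a).inf (σ.tsec_rightSided b))]
  · exact inf_eq_left.2 (inf_le_left.trans (σ.tsec_le a))
  · rw [star_inf, σ.sec_inf, σ.sec_inf, σ.sec_star_tsec, σ.sec_star_tsec]

theorem tsec_sSup (S : Set Q) : σ.tsec (sSup S) = ⨆ a ∈ S, σ.tsec a := by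
  have h : ⨆ a ∈ S, σ.tsec a = sSup (σ.tsec '' S) := by rw [sSup_image]
  have hr : IsRightSided (sSup (σ.tsec '' S)) := by
    apply IsRightSided.sSup
    rintro _ ⟨a, -, rfl⟩
    exact σ.tsec_rightSided a
  rw [h, σ.tsec_eq_of hr]
  · apply inf_eq_left.2
    apply sSup_le
    rintro _ ⟨a, -, rfl⟩
    exact σ.tsec_le a
  · rw [star_sSup, iSup_image, ← sSup_image (f := fun a => star (σ.tsec a)), σ.sec_sSup,
      iSup_image, σ.sec_sSup]
    simp only [σ.sec_star_tsec]

theorem tsec_mono {a b : Q} (h : a ≤ b) : σ.tsec a ≤ σ.tsec b := by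
  have h1 := σ.tsec_inf a b
  rw [inf_eq_left.2 h] at h1
  rw [h1]; exact inf_le_right

theorem sec_sec (a : Q) : σ.sec (σ.sec a) = σ.sec a := by
  rw [σ.sec_rightSided_eq _ (σ.sec_rightSided a)]
  exact inf_eq_left.2 (σ.sec_le a)

theorem tsec_sec (a : Q) : σ.tsec (σ.sec a) = σ.tsec a := by
  simp only [tsec, sec_sec]

/-- The inverse `σ⁻¹ = (V, i ∘ t)` of a local bisection. -/
noncomputable instance : Inv (LocalBisection Q) where
  inv σ :=
    { dom := σ.cod
      sec := fun a => σ.tsec (star a)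
      dom_rightSided := σ.cod_rightSided
      sec_rightSided := fun _ => σ.tsec_rightSided _
      sec_top := by rw [star_top, σ.tsec_top]
      sec_inf := fun a b => by rw [star_inf, σ.tsec_inf]
      sec_sSup := fun S => by
        rw [star_sSup, ← sSup_image, σ.tsec_sSup, iSup_image]
      sec_rightSided_eq := fun z hz => σ.tsec_star hz
      open_mono := ⟨⟨σ.dom, σ.dom_rightSided⟩, σ.action.symm, fun z => by
        have : (⟨σ.sec z.1, σ.sec_rightSided _, σ.sec_le _⟩ : Seg σ.dom) =
            ⟨z.1 ⊓ σ.dom, z.2.inf σ.dom_rightSided, inf_le_right⟩ :=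
          Subtype.ext (σ.sec_rightSided_eq _ z.2)
        rw [star_star, tsec, this]⟩ }

theorem inv_sec (a : Q) : (σ⁻¹).sec a = σ.tsec (star a) := rfl

theorem ext_sec {σ τ : LocalBisection Q} (h : ∀ a, σ.sec a = τ.sec a) : σ = τ :=
  LocalBisection.ext (by rw [← σ.sec_top, h, τ.sec_top]) (funext h)

theorem sec_star_inv_sec (a : Q) : σ.sec (star (σ⁻¹.sec a)) = σ.sec (star a) := by
  rw [inv_sec, sec_star_tsec]

theorem sec_star_inf_cod {z : Q} (hz : IsRightSided z) :
    σ.sec (star (z ⊓ σ.cod)) = σ.sec (star z) := by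
  rw [σ.sec_star hz, σ.sec_star (hz.inf σ.cod_rightSided)]
  simp only [inf_assoc, inf_idem]

theorem dom_le_inv_cod : σ.dom ≤ (σ⁻¹).cod := by
  have h := (σ⁻¹).sec_star_inf_cod σ.dom_rightSided
  rw [inv_sec, inv_sec, star_star, star_star] at h
  have h2 := congrArg (fun x => σ.sec (star x)) h
  simp only [sec_star_tsec] at h2
  rw [σ.sec_rightSided_eq _ σ.dom_rightSided,
    σ.sec_rightSided_eq _ (σ.dom_rightSided.inf (σ⁻¹).cod_rightSided), inf_idem] at h2
  rw [← h2]
  exact inf_le_left.trans inf_le_right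

theorem inv_inv_eq : σ⁻¹⁻¹ = σ := by
  apply ext_sec
  intro a
  have h : (σ⁻¹).sec (star (σ.sec a)) = (σ⁻¹).sec (star a) := by
    rw [inv_sec, inv_sec, star_star, star_star, tsec_sec]
  rw [inv_sec, (σ⁻¹).tsec_eq_of (σ.sec_rightSided a) h]
  exact inf_eq_left.2 ((σ.sec_le a).trans σ.dom_le_inv_cod)

/-- The function `f(a) = ⋁_{xy ≤ a} s_σ*(x ∧ s_τ*(y)*)`. -/
def mulSec (a : Q) : Q :=
  sSup {c | ∃ x y : Q, x * y ≤ a ∧ σ.sec (x ⊓ star (τ.sec y)) = c}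

/-- The left action `σ · a = ⋁_{x*y ≤ a} s*(x) ∧ y` of a local bisection on `Q`. -/
def act (a : Q) : Q := sSup {c | ∃ x y : Q, star x * y ≤ a ∧ σ.sec x ⊓ y = c}

theorem mulSec_eq (a : Q) : mulSec σ τ a = σ.sec (star (τ.act (star a))) := by
  unfold mulSec act
  rw [star_sSup, ← sSup_image, σ.sec_sSup, iSup_image, sSup_eq_iSup]
  apply le_antisymm
  · refine iSup₂_le ?_
    rintro _ ⟨x, y, h, rfl⟩
    refine le_iSup₂_of_le (τ.sec y ⊓ star x) ⟨y, star x, ?_, rfl⟩ ?_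
    · rw [← star_mul]; exact star_mono h
    · rw [star_inf, star_star, inf_comm]
  · refine iSup₂_le ?_
    rintro _ ⟨x, y, h, rfl⟩
    refine le_iSup₂_of_le (σ.sec (star y ⊓ star (τ.sec x))) ⟨star y, x, ?_, rfl⟩ ?_
    · rw [← star_le_iff] at h; simpa using h
    · rw [star_inf, inf_comm]

theorem mulSec_sSup (h : ∀ S : Set Q, τ.act (sSup S) = ⨆ a ∈ S, τ.act a) (S : Set Q) :
    mulSec σ τ (sSup S) = ⨆ a ∈ S, mulSec σ τ a := by
  rw [mulSec_eq, star_sSup, ← sSup_image, h, iSup_image, ← sSup_image, star_sSup, iSup_image,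
    ← sSup_image, σ.sec_sSup, iSup_image]
  simp only [mulSec_eq]

theorem le_mulSec {a x y : Q} (h : x * y ≤ a) :
    σ.sec (x ⊓ star (τ.sec y)) ≤ mulSec σ τ a := le_sSup ⟨x, y, h, rfl⟩

theorem mulSec_mono {a b : Q} (h : a ≤ b) : mulSec σ τ a ≤ mulSec σ τ b :=
  sSup_le_sSup fun _ ⟨x, y, hxy, hc⟩ => ⟨x, y, hxy.trans h, hc⟩

theorem mulSec_top : mulSec σ τ ⊤ = σ.sec (star τ.dom) := by
  apply le_antisymm
  · refine sSup_le ?_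
    rintro _ ⟨x, y, -, rfl⟩
    exact σ.sec_mono (inf_le_right.trans (star_mono (τ.sec_le y)))
  · have h := le_mulSec σ τ (le_top : (⊤ : Q) * ⊤ ≤ ⊤)
    rwa [top_inf_eq, τ.sec_top] at h

theorem mulSec_inf (a b : Q) : mulSec σ τ (a ⊓ b) = mulSec σ τ a ⊓ mulSec σ τ b := by
  apply le_antisymm (le_inf (mulSec_mono σ τ inf_le_left) (mulSec_mono σ τ inf_le_right))
  unfold mulSec
  rw [sSup_inf_sSup]
  refine iSup₂_le ?_
  rintro ⟨-, -⟩ ⟨⟨x, y, h, rfl⟩, ⟨x', y', h', rfl⟩⟩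
  refine le_sSup ⟨x ⊓ x', y ⊓ y', le_inf ?_ ?_, ?_⟩
  · exact (mul_mono inf_le_left inf_le_left).trans h
  · exact (mul_mono inf_le_right inf_le_right).trans h'
  · rw [← σ.sec_inf, τ.sec_inf, star_inf, inf_inf_inf_comm]

section Semiopen

variable [IsSemiopen Q]

theorem sec_le_mul_top (y : Q) : τ.sec y ≤ y * ⊤ := by
  refine (τ.sec_mono (le_mul_top y)).trans ?_
  rw [τ.sec_rightSided_eq _ (isRightSided_mul_top y)]
  exact inf_le_left

theorem mulSec_rightSided_eq {z : Q} (hz : IsRightSided z) :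
    mulSec σ τ z = z ⊓ σ.sec (star τ.dom) := by
  apply le_antisymm
  · refine sSup_le ?_
    rintro _ ⟨x, y, h, rfl⟩
    refine le_inf ?_ (σ.sec_mono (inf_le_right.trans (star_mono (τ.sec_le y))))
    have h1 : x ⊓ star (τ.sec y) ≤ z := by
      calc x ⊓ star (τ.sec y) ≤ x ⊓ star (y * ⊤) :=
            inf_le_inf_left _ (star_mono (τ.sec_le_mul_top y))
        _ ≤ (x ⊓ star (y * ⊤)) * ⊤ := le_mul_top _
        _ = x * (y * ⊤ ⊓ ⊤) := (balanced_rightSided (isRightSided_mul_top y) _ _).symm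
        _ = x * y * ⊤ := by rw [inf_top_eq, mul_assoc]
        _ ≤ z * ⊤ := mul_mono h le_rfl
        _ ≤ z := hz
    refine (σ.sec_mono h1).trans ?_
    rw [σ.sec_rightSided_eq _ hz]
    exact inf_le_left
  · have h := le_mulSec σ τ (hz : z * ⊤ ≤ z)
    rw [σ.sec_inf, τ.sec_top, σ.sec_rightSided_eq _ hz] at h
    refine le_trans (le_inf (le_inf inf_le_left ?_) inf_le_right) h
    exact inf_le_right.trans (σ.sec_le _)

theorem mulSec_star {z : Q} (hz : IsRightSided z) :
    mulSec σ τ (star z) = σ.sec (star (τ.sec (star z))) := by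
  apply le_antisymm
  · refine sSup_le ?_
    rintro _ ⟨x, y, h, rfl⟩
    have hw := isRightSided_mul_top (star x)
    apply σ.sec_mono
    have h1 : x ≤ star (star x * ⊤) := by
      rw [star_mul, star_star, star_top]; exact le_top_mul x
    calc x ⊓ star (τ.sec y) ≤ star (star x * ⊤) ⊓ star (τ.sec y) := inf_le_inf_right _ h1
      _ = star (star x * ⊤ ⊓ τ.sec y) := (star_inf _ _).symm
      _ ≤ star (τ.sec (star z)) := star_mono ?_
    have h2 : star x * ⊤ ⊓ y ≤ star z := by
      calc star x * ⊤ ⊓ y ≤ ⊤ * (star x * ⊤ ⊓ y) := le_top_mul _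
        _ = (⊤ ⊓ ⊤ * star (star x)) * y := IsBalanced.balanced _ _ _
        _ = ⊤ * (x * y) := by rw [top_inf_eq, star_star, mul_assoc]
        _ ≤ ⊤ * star z := mul_mono le_rfl h
        _ = star z := hz.top_mul_star_eq
    refine le_trans ?_ (τ.sec_mono h2)
    rw [τ.sec_inf, τ.sec_rightSided_eq _ hw]
    exact le_inf (le_inf inf_le_left (inf_le_right.trans (τ.sec_le y))) inf_le_right
  · have h := le_mulSec σ τ (hz.top_mul_star_eq.le)
    rwa [top_inf_eq] at h

theorem mulSec_open_mono : ∃ (V : RS Q) (α : Seg V.1 ≃o Seg (σ.sec (star τ.dom))), ∀ z : RS Q,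
    mulSec σ τ (star z.1) = (α ⟨z.1 ⊓ V.1, z.2.inf V.2, inf_le_right⟩).1 := by
  have hV : IsRightSided (τ.tsec σ.cod) := τ.tsec_rightSided _
  have hf : ∀ z, IsRightSided (σ.sec (star (τ.sec (star z)))) := fun z => σ.sec_rightSided _
  have hgf : ∀ z, IsRightSided z →
      τ.tsec (σ.tsec (σ.sec (star (τ.sec (star z))))) = z ⊓ τ.tsec σ.cod := by
    intro z hz
    rw [tsec_sec, σ.tsec_star (τ.sec_rightSided _), tsec_inf, tsec_sec, τ.tsec_star hz, inf_assoc,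
      inf_eq_right.2 (τ.tsec_le σ.cod)]
  have hfg : ∀ w, IsRightSided w → w ≤ σ.sec (star τ.dom) →
      σ.sec (star (τ.sec (star (τ.tsec (σ.tsec w))))) = w := by
    intro w hw hle
    have hw' : σ.sec w = w := by
      rw [σ.sec_rightSided_eq _ hw]; exact inf_eq_left.2 (hle.trans (σ.sec_le _))
    have h1 : σ.tsec w ≤ τ.dom := by
      have h2 := σ.tsec_mono hle
      rw [tsec_sec, σ.tsec_star τ.dom_rightSided] at h2
      exact h2.trans inf_le_left
    rw [sec_star_tsec, τ.sec_rightSided_eq _ (σ.tsec_rightSided w), inf_eq_left.2 h1,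
      sec_star_tsec, hw']
  refine ⟨⟨τ.tsec σ.cod, hV⟩,
    { toFun := fun z => ⟨σ.sec (star (τ.sec (star z.1))), hf _,
        σ.sec_mono (star_mono (τ.sec_le _))⟩
      invFun := fun w => ⟨τ.tsec (σ.tsec w.1), τ.tsec_rightSided _, τ.tsec_mono (σ.tsec_le _)⟩
      left_inv := fun z => Subtype.ext ((hgf _ z.2.1).trans (inf_eq_left.2 z.2.2))
      right_inv := fun w => Subtype.ext (hfg _ w.2.1 w.2.2)
      map_rel_iff' := ?_ }, ?_⟩
  · intro z z'
    constructor
    · intro h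
      have h1 : σ.sec (star (τ.sec (star z.1))) ≤ σ.sec (star (τ.sec (star z'.1))) := h
      have h2 := τ.tsec_mono (σ.tsec_mono h1)
      rw [hgf _ z.2.1, hgf _ z'.2.1, inf_eq_left.2 z.2.2, inf_eq_left.2 z'.2.2] at h2
      exact h2
    · intro h
      exact σ.sec_mono (star_mono (τ.sec_mono (star_mono h)))
  · intro z
    change _ = σ.sec (star (τ.sec (star (z.1 ⊓ τ.tsec σ.cod))))
    rw [mulSec_star σ τ z.2, ← hgf _ z.2, hfg _ (hf _) (σ.sec_mono (star_mono (τ.sec_le _)))]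

/-- The product `στ`, which is defined when `f(a) = ⋁_{xy ≤ a} s_σ*(x ∧ s_τ*(y)*)` preserves
joins: its domain is `s_σ*(U_τ*)` and its section has the inverse image `f`. -/
def mul (h : ∀ S : Set Q, mulSec σ τ (sSup S) = ⨆ a ∈ S, mulSec σ τ a) : LocalBisection Q where
  dom := σ.sec (star τ.dom)
  sec := mulSec σ τ
  dom_rightSided := σ.sec_rightSided _
  sec_rightSided := fun a => by rw [mulSec_eq]; exact σ.sec_rightSided _
  sec_top := mulSec_top σ τ
  sec_inf := mulSec_inf σ τ
  sec_sSup := h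
  sec_rightSided_eq := fun _ hz => mulSec_rightSided_eq σ τ hz
  open_mono := mulSec_open_mono σ τ

end Semiopen

end LocalBisection

end LocalBisection

/-! ### Weak multiplicativity and embeddability -/

section Main

variable (Q : Type u) [InvolutiveQuantalFrame Q]

/-- `Q` is a weakly multiplicative open quantal frame: `υ` and all the actions `σ · (-)` preserve
joins, and the multiplication of local bisections (which is defined everywhere since the actions
preserve joins) is associative. -/
class IsWeaklyMultiplicative : Prop extends IsOpenQuantalFrame Q where
  upsilon_sSup : ∀ S : Set Q, upsilon (sSup S) = ⨆ a ∈ S, upsilon a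
  act_sSup : ∀ (σ : LocalBisection Q) (S : Set Q), σ.act (sSup S) = ⨆ a ∈ S, σ.act a
  mul_assoc : ∀ σ τ ν : LocalBisection Q,
    (σ.mul τ (σ.mulSec_sSup τ (act_sSup τ))).mul ν (LocalBisection.mulSec_sSup _ ν (act_sSup ν)) =
      σ.mul (τ.mul ν (τ.mulSec_sSup ν (act_sSup ν))) (LocalBisection.mulSec_sSup σ _ (act_sSup _))

variable {Q}
variable [IsWeaklyMultiplicative Q]

instance : Mul (LocalBisection Q) where
  mul σ τ := σ.mul τ (σ.mulSec_sSup τ (IsWeaklyMultiplicative.act_sSup τ))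

namespace LocalBisection

theorem mul_sec (σ τ : LocalBisection Q) (a : Q) : (σ * τ).sec a = mulSec σ τ a := rfl

theorem mul_inv_sec (σ : LocalBisection Q) (a : Q) :
    (σ * σ⁻¹).sec a = upsilon a ⊓ σ.dom := by
  rw [mul_sec, ← σ.sec_rightSided_eq _ (IsSemiopen.upsilon_rightSided a), mulSec, upsilon,
    σ.sec_sSup, sSup_eq_iSup]
  apply le_antisymm
  · refine iSup₂_le ?_
    rintro _ ⟨x, y, h, rfl⟩
    refine le_iSup₂_of_le (x ⊓ star y) ⟨x, star y, by rwa [star_star], rfl⟩ ?_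
    rw [σ.sec_inf, σ.sec_inf, sec_star_inv_sec]
  · refine iSup₂_le ?_
    rintro _ ⟨x, y, h, rfl⟩
    refine le_iSup₂_of_le _ ⟨x, star y, h, rfl⟩ ?_
    rw [σ.sec_inf, σ.sec_inf, sec_star_inv_sec, star_star]

theorem mul_inv_mul_sec (σ τ : LocalBisection Q) (a : Q) :
    (σ * σ⁻¹ * τ).sec a = τ.sec a ⊓ σ.dom := by
  rw [mul_sec, mulSec]
  conv_rhs => rw [← sSup_upsilon_inf a, τ.sec_sSup, iSup₂_inf_eq]
  rw [sSup_eq_iSup]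
  have key : ∀ x y : Q, (σ * σ⁻¹).sec (x ⊓ star (τ.sec y)) = τ.sec (upsilon x ⊓ y) ⊓ σ.dom := by
    intro x y
    rw [mul_inv_sec, upsilon_inf, upsilon_star, upsilon_rightSided_eq (τ.sec_rightSided y),
      τ.sec_inf, τ.sec_rightSided_eq _ (IsSemiopen.upsilon_rightSided x), inf_assoc (upsilon x) τ.dom,
      inf_eq_right.2 (τ.sec_le y), inf_assoc]
  apply le_antisymm
  · refine iSup₂_le ?_
    rintro _ ⟨x, y, h, rfl⟩
    exact le_iSup₂_of_le (upsilon x ⊓ y) ⟨x, y, h, rfl⟩ (key x y).le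
  · refine iSup₂_le ?_
    rintro _ ⟨x, y, h, rfl⟩
    exact le_iSup₂_of_le _ ⟨x, y, h, rfl⟩ (key x y).ge

/-- The inverse semigroup `S(Q)` of local bisections. -/
noncomputable instance : InverseSemigroup (LocalBisection Q) where
  mul_assoc := IsWeaklyMultiplicative.mul_assoc
  inv_inv := inv_inv_eq
  mul_inv_mul σ := ext_sec fun a => by
    rw [mul_inv_mul_sec]; exact inf_eq_left.2 (σ.sec_le a)
  mul_inv_comm σ τ := ext_sec fun a => by
    rw [mul_inv_mul_sec, mul_inv_mul_sec, mul_inv_sec, mul_inv_sec, inf_right_comm]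

/-- The natural order is given by restriction. -/
theorem natLE_iff {σ τ : LocalBisection Q} :
    NatLE σ τ ↔ ∀ a, σ.sec a = τ.sec a ⊓ σ.dom := by
  constructor
  · intro h a
    conv_lhs => rw [show σ = σ * σ⁻¹ * τ from h]
    exact mul_inv_mul_sec σ τ a
  · intro h
    exact ext_sec fun a => (h a).trans (mul_inv_mul_sec σ τ a).symm

theorem dom_le_of_natLE {σ τ : LocalBisection Q} (h : NatLE σ τ) : σ.dom ≤ τ.dom := by
  rw [← σ.sec_top, natLE_iff.1 h, τ.sec_top]; exact inf_le_left

end LocalBisection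

variable (Q) in
/-- The completion `L^∨(S(Q))` of the inverse semigroup of local bisections. -/
abbrev Cover : Type u := Completion (LocalBisection Q)

namespace LocalBisection

/-- The local bisection `(W, u ∘ k_W)`, where `u* = υ`. -/
def unitOn (W : Q) (hW : IsRightSided W) : LocalBisection Q where
  dom := W
  sec := fun a => upsilon a ⊓ W
  dom_rightSided := hW
  sec_rightSided := fun a => (IsSemiopen.upsilon_rightSided a).inf hW
  sec_top := by rw [upsilon_rightSided_eq IsRightSided.top, top_inf_eq]
  sec_inf := fun a b => by rw [upsilon_inf, inf_inf_distrib_right]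
  sec_sSup := fun S => by rw [IsWeaklyMultiplicative.upsilon_sSup, iSup₂_inf_eq]
  sec_rightSided_eq := fun z hz => by rw [upsilon_rightSided_eq hz]
  open_mono := ⟨⟨W, hW⟩, OrderIso.refl _, fun z => by
    rw [upsilon_star, upsilon_rightSided_eq z.2]
    rfl⟩

theorem dom_le_of_isJoin {X : Set (LocalBisection Q)} {σ : LocalBisection Q} (h : IsJoin X σ) :
    σ.dom ≤ ⨆ ρ ∈ X, ρ.dom := by
  have hW : IsRightSided (⨆ ρ ∈ X, ρ.dom) := by
    rw [← sSup_image]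
    apply IsRightSided.sSup
    rintro _ ⟨ρ, -, rfl⟩
    exact ρ.dom_rightSided
  have hu : ∀ ρ ∈ X, NatLE ρ (unitOn _ hW * (unitOn _ hW)⁻¹ * σ) := by
    intro ρ hρ
    rw [natLE_iff]
    intro a
    have h1 : ρ.dom ≤ (unitOn _ hW).dom :=
      le_iSup₂_of_le (f := fun (ρ : LocalBisection Q) (_ : ρ ∈ X) => ρ.dom) ρ hρ le_rfl
    rw [mul_inv_mul_sec, inf_assoc, inf_eq_right.2 h1]
    exact natLE_iff.1 (h.1 ρ hρ) a
  have h2 := dom_le_of_natLE (h.2 _ hu)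
  rw [← sec_top (_ * σ), mul_inv_mul_sec] at h2
  exact h2.trans inf_le_right

end LocalBisection

/-- The map `j : Q → L^∨(S(Q))`, `j(a) = {σ : s_σ*(a) = U_σ}`. -/
noncomputable def j (a : Q) : Cover Q where
  carrier := {σ | σ.sec a = σ.dom}
  lower := fun {σ τ} h hτ => by
    change σ.sec a = σ.dom
    have hτ' : τ.sec a = τ.dom := hτ
    rw [LocalBisection.natLE_iff.1 h, hτ']
    exact inf_eq_right.2 (LocalBisection.dom_le_of_natLE h)
  join_mem := fun X σ hX _ hσ => by
    apply le_antisymm (σ.sec_le a)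
    refine (LocalBisection.dom_le_of_isJoin hσ).trans (iSup₂_le fun ρ hρ => ?_)
    have h1 : ρ.sec a = ρ.dom := hX hρ
    rw [← h1, LocalBisection.natLE_iff.1 (hσ.1 ρ hρ)]
    exact inf_le_left

end Main

section Embeddable

variable (Q : Type u) [InvolutiveQuantalFrame Q]

/-- The tensor product `Q ⊗_{R(Q)} Q` for the actions `a·z = a ∧ z*` and `z·b = b ∧ z`. -/
abbrev TensorQQ : Type u :=
  ModTensor (fun (a : Q) (z : RS Q) => a ⊓ star z.1) (fun (z : RS Q) (b : Q) => b ⊓ z.1)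

/-- The reduced multiplication `μ₀ : Q ⊗_{R(Q)} Q → Q`, `a ⊗ b ↦ ab`; see `isMiddleLinear_mul`. -/
def reducedMul : TensorQQ Q → Q := ModTensor.lift fun a b => a * b

/-- `Q` is multiplicative: it is balanced, and the reduced multiplication has a right adjoint,
which preserves joins. -/
def IsMultiplicative : Prop :=
  IsBalanced Q ∧ ∃ g : Q → TensorQQ Q, GaloisConnection (reducedMul Q) g ∧
    ∀ S : Set Q, g (sSup S) = ⨆ a ∈ S, g a

/-- In a semiopen quantal frame the multiplication factors through `Q ⊗_{R(Q)} Q`. -/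
theorem isMiddleLinear_mul [IsSemiopen Q] :
    ModTensor.IsMiddleLinear (fun (a : Q) (z : RS Q) => a ⊓ star z.1)
      (fun (z : RS Q) (b : Q) => b ⊓ z.1) (fun a b => a * b) where
  map_sSup_left _ _ := sSup_mul_distrib
  map_sSup_right _ _ := mul_sSup_distrib
  map_middle a z b := by rw [inf_comm b, balanced_rightSided z.2]

variable [IsWeaklyMultiplicative Q]

/-- The tensor product `L^∨(S(Q)) ⊗_{R(Q)} Q`, where `R(Q)` acts on `L^∨(S(Q))` along `j`:
`X·z = X ∧ j(z*)`, so that `j` commutes with the actions. -/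
abbrev TensorCoverQ : Type u :=
  ModTensor (fun (X : Cover Q) (z : RS Q) => X ⊓ j (star z.1))
    (fun (z : RS Q) (b : Q) => b ⊓ z.1)

/-- The map `j ⊗ id : Q ⊗_{R(Q)} Q → L^∨(S(Q)) ⊗_{R(Q)} Q`, `a ⊗ b ↦ j(a) ⊗ b`. -/
noncomputable def jTensorId : TensorQQ Q → TensorCoverQ Q :=
  ModTensor.lift fun a b => ModTensor.tmul _ _ (j a) b

/-- `Q` is weakly embeddable: `σ̂ j(a) = j(σ · a)`, where `σ̂` is the principal ideal of `σ`. -/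
def IsWeaklyEmbeddable : Prop :=
  ∀ (σ : LocalBisection Q) (a : Q), Completion.principal σ * j a = j (σ.act a)

/-- `Q` is embeddable: it is weakly embeddable and `j ⊗ id` is mono. -/
def IsEmbeddable : Prop :=
  IsWeaklyEmbeddable Q ∧ Function.Injective (jTensorId Q)

end Embeddable

end InvolutiveQuantalFrame

/-!
Let `g(c) = {(x, y) : xy ≤ c}` be the right adjoint of the reduced multiplication. The map
`j ⊗ id` preserves joins, because `j` does (`InvolutiveQuantalFrame.j_sSup`), and it is injective,
so it suffices that `c ↦ (j ⊗ id)(g(c))` preserves joins. This composite is computed explicitly: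
`(j ⊗ id)(g(c)) = ⋁_σ σ̂ ⊗ σ⁻¹·c` (`InvolutiveQuantalFrame.jTensorId_mulAdjoint`), and each
`σ⁻¹·(-)` preserves joins by weak multiplicativity.

For the formula, write `V` for the codomain of `σ` and `t*` for the inverse image of its codomain
section, so that `(σ⁻¹)* (a*) = t*(a)`.
* If `xy ≤ c` then `j(x) ⊗ y` is the join of the `σ̂ ⊗ y` with `σ ∈ j(x)`. For these
  `σ̂ ⊗ y = σ̂ ⊗ (y ∧ V)`, and `V = t*(x)`, so `y ∧ V ≤ σ⁻¹·c`.
* Conversely `σ⁻¹·c` is the join of the `t*(w) ∧ y` with `wy ≤ c`. The factor `t*(w)` moves to the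
  left side of the tensor, where `σ̂ ∧ j(t*(w)*) ≤ j(w)`.

That `j` preserves joins amounts to the fact that a local bisection is the join of its restrictions
to the members of a cover of its domain, which form a compatible set since they have a common upper
bound.
-/

namespace InvolutiveQuantalFrame

/-! ### Compatibility in inverse semigroups -/

namespace InverseSemigroup

variable {S : Type*} [InverseSemigroup S]

theorem inv_mul_mul_inv (x : S) : x⁻¹ * x * x⁻¹ = x⁻¹ := by
  simpa only [inv_inv] using mul_inv_mul x⁻¹

theorem isIdempotentElem_mul_inv (x : S) : IsIdempotentElem (x * x⁻¹) := by
  rw [IsIdempotentElem, ← mul_assoc, mul_inv_mul]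

theorem isIdempotentElem_inv_mul (x : S) : IsIdempotentElem (x⁻¹ * x) := by
  rw [IsIdempotentElem, ← mul_assoc, inv_mul_mul_inv]

theorem inv_eq_of_isIdempotentElem {e : S} (he : IsIdempotentElem e) : e⁻¹ = e := by
  -- By `key`, `e⁻¹` is a product of commuting idempotents, hence idempotent, so `key` applies to it;
  -- the two products so obtained for `e⁻¹` and `e` coincide.
  have key : ∀ f : S, IsIdempotentElem f → f⁻¹ = (f⁻¹ * f) * (f * f⁻¹) := by
    intro f hf
    calc f⁻¹ = f⁻¹ * (f * f) * f⁻¹ := by rw [hf.eq, inv_mul_mul_inv]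
      _ = (f⁻¹ * f) * (f * f⁻¹) := by simp only [mul_assoc]
  have hcomm : (e * e⁻¹) * (e⁻¹ * e) = (e⁻¹ * e) * (e * e⁻¹) := by
    simpa only [inv_inv] using mul_inv_comm e e⁻¹
  have h1 : IsIdempotentElem e⁻¹ := by
    rw [key e he]
    exact (isIdempotentElem_inv_mul e).mul_of_commute hcomm.symm (isIdempotentElem_mul_inv e)
  have h2 := key e⁻¹ h1
  rw [inv_inv, hcomm, ← key e he] at h2
  exact h2.symm

theorem commute_of_isIdempotentElem {e f : S} (he : IsIdempotentElem e)
    (hf : IsIdempotentElem f) : Commute e f := by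
  have h := mul_inv_comm e f
  rwa [inv_eq_of_isIdempotentElem he, inv_eq_of_isIdempotentElem hf, he.eq, hf.eq] at h

theorem inv_eq_of_mul_mul {x y : S} (h : x * y * x = x) (h' : y * x * y = y) : x⁻¹ = y := by
  have hxy : IsIdempotentElem (x * y) := by rw [IsIdempotentElem, ← mul_assoc, h]
  have hyx : IsIdempotentElem (y * x) := by rw [IsIdempotentElem, ← mul_assoc, h']
  have c1 := (commute_of_isIdempotentElem (isIdempotentElem_inv_mul x) hyx).eq
  have c2 := (commute_of_isIdempotentElem (isIdempotentElem_mul_inv x) hxy).eq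
  have e1 : x⁻¹ = y * x * x⁻¹ := by
    calc x⁻¹ = x⁻¹ * (x * y * x) * x⁻¹ := by rw [h, inv_mul_mul_inv]
      _ = (x⁻¹ * x) * (y * x) * x⁻¹ := by simp only [mul_assoc]
      _ = y * (x * x⁻¹ * x) * x⁻¹ := by rw [c1]; simp only [mul_assoc]
      _ = y * x * x⁻¹ := by rw [mul_inv_mul]
  calc x⁻¹ = y * x * x⁻¹ := e1
    _ = y * (x * y * x) * x⁻¹ := by rw [h]
    _ = y * ((x * y) * (x * x⁻¹)) := by simp only [mul_assoc]
    _ = y * (x * x⁻¹ * x * y) := by rw [← c2]; simp only [mul_assoc]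
    _ = y * x * y := by rw [mul_inv_mul]; simp only [mul_assoc]
    _ = y := h'

theorem inv_idempotent_mul {e : S} (he : IsIdempotentElem e) (s : S) :
    (e * s)⁻¹ = s⁻¹ * e := by
  have c := (commute_of_isIdempotentElem he (isIdempotentElem_mul_inv s)).eq
  apply inv_eq_of_mul_mul
  · calc e * s * (s⁻¹ * e) * (e * s) = e * (s * s⁻¹) * (e * e) * s := by simp only [mul_assoc]
      _ = (e * e) * (s * s⁻¹ * s) := by
        rw [he.eq, c, mul_assoc (s * s⁻¹) e e, he.eq, ← c]; simp only [mul_assoc]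
      _ = e * s := by rw [he.eq, mul_inv_mul]
  · calc s⁻¹ * e * (e * s) * (s⁻¹ * e) = s⁻¹ * ((e * e) * (s * s⁻¹)) * e := by
          simp only [mul_assoc]
      _ = (s⁻¹ * s * s⁻¹) * (e * e) := by rw [he.eq, c]; simp only [mul_assoc, he.eq]
      _ = s⁻¹ * e := by rw [he.eq, inv_mul_mul_inv]

/-- Elements with a common upper bound are compatible. -/
theorem isCompatibleSet_of_natLE {X : Set S} {s : S} (h : ∀ x ∈ X, NatLE x s) :
    IsCompatibleSet X := by
  intro x hx y hy
  have he := isIdempotentElem_mul_inv x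
  have hf := isIdempotentElem_mul_inv y
  have hs := isIdempotentElem_mul_inv s
  have hx' : x = x * x⁻¹ * s := h x hx
  have hy' : y = y * y⁻¹ * s := h y hy
  generalize x * x⁻¹ = e at he hx'
  generalize y * y⁻¹ = f at hf hy'
  have hef := he.mul_of_commute (commute_of_isIdempotentElem he hf) hf
  subst hx' hy'
  constructor
  · rw [inv_idempotent_mul hf,
      show e * s * (s⁻¹ * f) = e * (s * s⁻¹) * f by simp only [mul_assoc]]
    have h1 := he.mul_of_commute (commute_of_isIdempotentElem he hs) hs
    exact h1.mul_of_commute (commute_of_isIdempotentElem h1 hf) hf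
  · rw [inv_idempotent_mul he,
      show s⁻¹ * e * (f * s) = s⁻¹ * (e * f) * s by simp only [mul_assoc]]
    have c := (commute_of_isIdempotentElem hef hs).eq
    calc s⁻¹ * (e * f) * s * (s⁻¹ * (e * f) * s)
        = s⁻¹ * ((e * f) * (s * s⁻¹)) * (e * f) * s := by simp only [mul_assoc]
      _ = (s⁻¹ * s * s⁻¹) * ((e * f) * (e * f)) * s := by rw [c]; simp only [mul_assoc]
      _ = s⁻¹ * (e * f) * s := by rw [hef.eq, inv_mul_mul_inv]

end InverseSemigroup

/-! ### Restrictions of local bisections -/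

section Restriction

variable {Q : Type*} [InvolutiveQuantalFrame Q] [IsWeaklyMultiplicative Q]

namespace LocalBisection

theorem natLE_refl (σ : LocalBisection Q) : NatLE σ σ :=
  natLE_iff.2 fun a => (inf_eq_left.2 (σ.sec_le a)).symm

/-- The restriction of `σ` to the right-sided element `W`; its domain is `U_σ ∧ W`. -/
noncomputable def restrict (σ : LocalBisection Q) (W : Q) (hW : IsRightSided W) :
    LocalBisection Q :=
  unitOn W hW * (unitOn W hW)⁻¹ * σ

theorem restrict_sec (σ : LocalBisection Q) {W : Q} (hW : IsRightSided W) (a : Q) :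
    (σ.restrict W hW).sec a = σ.sec a ⊓ W :=
  mul_inv_mul_sec _ σ a

theorem restrict_dom (σ : LocalBisection Q) {W : Q} (hW : IsRightSided W) :
    (σ.restrict W hW).dom = σ.dom ⊓ W := by
  rw [← sec_top, restrict_sec, σ.sec_top]

theorem restrict_natLE (σ : LocalBisection Q) {W : Q} (hW : IsRightSided W) :
    NatLE (σ.restrict W hW) σ := by
  rw [natLE_iff]
  intro a
  rw [restrict_sec, restrict_dom, ← inf_assoc, inf_eq_left.2 (σ.sec_le a)]

/-- A local bisection is the join of any elements below it whose domains cover its domain. -/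
theorem isJoin_of_dom_le {σ : LocalBisection Q} {X : Set (LocalBisection Q)}
    (hX : ∀ ρ ∈ X, NatLE ρ σ) (h : σ.dom ≤ ⨆ ρ ∈ X, ρ.dom) : IsJoin X σ := by
  refine ⟨hX, fun τ hτ => natLE_iff.2 fun a => ?_⟩
  have key : ∀ b : Q, b ≤ σ.dom → b = ⨆ ρ ∈ X, b ⊓ ρ.dom := fun b hb => by
    rw [← inf_iSup₂_eq]; exact (inf_eq_left.2 (hb.trans h)).symm
  rw [key _ (σ.sec_le a), key (τ.sec a ⊓ σ.dom) inf_le_right]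
  refine iSup_congr fun ρ => iSup_congr fun hρ => ?_
  rw [← natLE_iff.1 (hX ρ hρ) a, inf_assoc, inf_eq_right.2 (dom_le_of_natLE (hX ρ hρ)),
    ← natLE_iff.1 (hτ ρ hρ) a]

end LocalBisection

/-! ### The map `j` -/

theorem mem_j {σ : LocalBisection Q} {a : Q} : σ ∈ (j a).carrier ↔ σ.sec a = σ.dom := Iff.rfl

theorem j_inf (a b : Q) : j (a ⊓ b) = j a ⊓ j b := by
  apply le_antisymm
  · refine le_inf ?_ ?_
    · intro σ hσ
      exact le_antisymm (σ.sec_le a) ((mem_j.1 hσ).ge.trans (σ.sec_mono inf_le_left))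
    · intro σ hσ
      exact le_antisymm (σ.sec_le b) ((mem_j.1 hσ).ge.trans (σ.sec_mono inf_le_right))
  · intro σ hσ
    have ha : σ.sec a = σ.dom := (inf_le_left : j a ⊓ j b ≤ j a) hσ
    have hb : σ.sec b = σ.dom := (inf_le_right : j a ⊓ j b ≤ j b) hσ
    change σ.sec (a ⊓ b) = σ.dom
    rw [σ.sec_inf, ha, hb, inf_idem]

theorem j_mono {a b : Q} (h : a ≤ b) : j a ≤ j b := by
  rw [← inf_eq_left.2 h, j_inf]; exact inf_le_right

theorem j_sSup (S : Set Q) : j (sSup S) = ⨆ a ∈ S, j a := by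
  apply le_antisymm
  · intro σ hσ
    -- The elements `s*(a)`, `a ∈ S`, cover the domain of `σ`, and `σ` restricted to `s*(a)` is in `j(a)`.
    let r : Q → LocalBisection Q := fun a => σ.restrict (σ.sec a) (σ.sec_rightSided a)
    have hr : ∀ ρ ∈ r '' S, NatLE ρ σ := by
      rintro _ ⟨a, -, rfl⟩
      exact σ.restrict_natLE _
    refine Completion.join_mem _ (r '' S) σ ?_ (InverseSemigroup.isCompatibleSet_of_natLE hr)
      (LocalBisection.isJoin_of_dom_le hr ?_)
    · rintro _ ⟨a, ha, rfl⟩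
      have hmem : r a ∈ (j a).carrier := by
        rw [mem_j, LocalBisection.restrict_sec, LocalBisection.restrict_dom, inf_idem]
        exact (inf_eq_right.2 (σ.sec_le a)).symm
      exact (le_iSup₂_of_le (f := fun a (_ : a ∈ S) => j a) a ha le_rfl) hmem
    · rw [iSup_image, ← mem_j.1 hσ, σ.sec_sSup]
      refine iSup₂_mono fun a _ => ?_
      rw [LocalBisection.restrict_dom]
      exact le_inf (σ.sec_le a) le_rfl
  · exact iSup₂_le fun a ha => j_mono (le_sSup ha)

theorem j_eq_iSup_principal (a : Q) :
    j a = ⨆ σ ∈ (j a).carrier, Completion.principal σ := by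
  apply le_antisymm
  · intro σ hσ
    exact (le_iSup₂_of_le (f := fun (σ : LocalBisection Q) (_ : σ ∈ (j a).carrier) =>
      Completion.principal σ) σ hσ le_rfl) σ.natLE_refl
  · exact iSup₂_le fun σ hσ ρ hρ => (j a).lower hρ hσ

theorem principal_le_j_star_cod (σ : LocalBisection Q) :
    Completion.principal σ ≤ j (star σ.cod) := by
  intro ρ hρ
  refine (j _).lower hρ ?_
  rw [mem_j, ← σ.tsec_top, σ.sec_star_tsec, σ.sec_top]

theorem principal_inf_j_star_tsec_le (σ : LocalBisection Q) (w : Q) :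
    Completion.principal σ ⊓ j (star (σ.tsec w)) ≤ j w := by
  intro ρ hρ
  have h1 : NatLE ρ σ :=
    (inf_le_left : Completion.principal σ ⊓ j (star (σ.tsec w)) ≤ _) hρ
  have h2 : ρ.sec (star (σ.tsec w)) = ρ.dom :=
    (inf_le_right : Completion.principal σ ⊓ j (star (σ.tsec w)) ≤ _) hρ
  rw [mem_j, ← h2, LocalBisection.natLE_iff.1 h1, LocalBisection.natLE_iff.1 h1,
    σ.sec_star_tsec]

end Restriction

/-! ### The right adjoint of the reduced multiplication -/

section Adjoint

variable (Q : Type*) [InvolutiveQuantalFrame Q] [IsWeaklyMultiplicative Q]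

theorem isMiddleLinear_j_tmul :
    ModTensor.IsMiddleLinear (C := TensorCoverQ Q) (fun (a : Q) (z : RS Q) => a ⊓ star z.1)
      (fun (z : RS Q) (b : Q) => b ⊓ z.1) (fun a b => ModTensor.tmul _ _ (j a) b) where
  map_sSup_left S b := by
    rw [j_sSup, ← sSup_image, ModTensor.isMiddleLinear_tmul.map_sSup_left, iSup_image]
  map_sSup_right a S := ModTensor.isMiddleLinear_tmul.map_sSup_right _ _
  map_middle a z b := by
    rw [j_inf]
    exact ModTensor.isMiddleLinear_tmul.map_middle (j a) z b

/-- The right adjoint `c ↦ {(x, y) : xy ≤ c}` of the reduced multiplication. -/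
def mulAdjoint (c : Q) : TensorQQ Q := (isMiddleLinear_mul Q).adjoint c

variable {Q}

/-- The key formula `(j ⊗ id)(g(c)) = ⋁_σ σ̂ ⊗ σ⁻¹·c`, in which only the actions `σ⁻¹·(-)` depend
on `c`. -/
theorem jTensorId_mulAdjoint (c : Q) :
    jTensorId Q (mulAdjoint Q c) =
      ⨆ σ : LocalBisection Q,
        (ModTensor.tmul _ _ (Completion.principal σ) (σ⁻¹.act c) : TensorCoverQ Q) := by
  have hT := ModTensor.isMiddleLinear_tmul
    (ra := fun (X : Cover Q) (z : RS Q) => X ⊓ j (star z.1))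
    (la := fun (z : RS Q) (b : Q) => b ⊓ z.1)
  apply le_antisymm
  · refine sSup_le ?_
    rintro _ ⟨x, y, hxy, rfl⟩
    have hxy' : x * y ≤ c := hxy
    beta_reduce
    rw [j_eq_iSup_principal x, ← sSup_image, hT.map_sSup_left, iSup_image]
    refine iSup₂_le fun σ hσ => le_iSup_of_le σ ?_
    have h1 := hT.map_middle (Completion.principal σ) ⟨σ.cod, σ.cod_rightSided⟩ y
    beta_reduce at h1
    rw [inf_eq_left.2 (principal_le_j_star_cod σ)] at h1
    rw [h1]
    refine hT.mono le_rfl ?_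
    -- Since `σ ∈ j(x)`, the inverse image of `x*` along the section of `σ⁻¹` is everything.
    have h2 : σ⁻¹.sec (star x) = σ.cod := by
      rw [LocalBisection.inv_sec, star_star, ← σ.tsec_sec, mem_j.1 hσ, ← σ.sec_top, σ.tsec_sec,
        σ.tsec_top]
    change y ⊓ σ.cod ≤ _
    rw [inf_comm, ← h2]
    exact le_sSup ⟨star x, y, by rwa [star_star], rfl⟩
  · refine iSup_le fun σ => ?_
    rw [LocalBisection.act, hT.map_sSup_right]
    refine iSup₂_le ?_
    rintro _ ⟨x, y, hxy, rfl⟩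
    have h1 := hT.map_middle (Completion.principal σ)
      ⟨σ.tsec (star x), σ.tsec_rightSided _⟩ y
    beta_reduce at h1
    rw [LocalBisection.inv_sec, inf_comm, ← h1]
    exact (hT.mono (principal_inf_j_star_tsec_le σ (star x)) le_rfl).trans
      (le_sSup ⟨star x, y, hxy, rfl⟩)

theorem jTensorId_mulAdjoint_sSup (S : Set Q) :
    jTensorId Q (mulAdjoint Q (sSup S)) = ⨆ c ∈ S, jTensorId Q (mulAdjoint Q c) := by
  simp only [jTensorId_mulAdjoint]
  have hcomm (f : Q → LocalBisection Q → TensorCoverQ Q) :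
      ⨆ c ∈ S, ⨆ σ, f c σ = ⨆ σ, ⨆ c ∈ S, f c σ := by
    simp only [iSup_comm (ι' := LocalBisection Q)]
  rw [hcomm]
  refine iSup_congr fun σ => ?_
  rw [IsWeaklyMultiplicative.act_sSup, ← sSup_image,
    ModTensor.isMiddleLinear_tmul.map_sSup_right, iSup_image]

end Adjoint

end InvolutiveQuantalFrame

theorem mainTheorem1 (Q : Type*) [InvolutiveQuantalFrame Q]
    [InvolutiveQuantalFrame.IsWeaklyMultiplicative Q]
    (hQ : InvolutiveQuantalFrame.IsEmbeddable Q) :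
    InvolutiveQuantalFrame.IsMultiplicative Q := by
  open InvolutiveQuantalFrame in
  refine ⟨inferInstance, mulAdjoint Q, (isMiddleLinear_mul Q).gc, fun S => hQ.2 ?_⟩
  open InvolutiveQuantalFrame in
  rw [jTensorId_mulAdjoint_sSup, ← sSup_image (f := mulAdjoint Q)]
  open InvolutiveQuantalFrame in
  exact ((ModTensor.lift_sSup (isMiddleLinear_j_tmul Q) _).trans iSup_image).symm
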